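/- **Theorem (Consistency of the penalized estimator in regression by composition).** *Model.* Let $\mathcal P$ be the set of signed measures of total mass $1$ on a measurable space $\Upsilon$. A flow is a faithful action $(p,v)\mapsto p\cdot v$ of the additive group of a real vector space $\mathbb V$ on $\mathcal P$ (i.e. $p\cdot 0=p$, $(p\cdot v)\cdot v'=p\cdot(v+v')$, and $p\cdot v=p\cdot v'$ for all $p$ implies $v=v'$). Fix $p_0\in\mathcal P$, flows of $\mathbb V_1,\dots,\mathbb V_K$ on $\mathcal P$, and for each covariate value $x$ vectors $X_k=X_k(x)\in\mathbb V_k^{d_k}$. For $\beta=(\beta_1,\dots,\beta_K)$, $\beta_k\in\mathbb R^{d_k}$, put $$P(\beta\mid x)=p_0\cdot\eta_1(x;\beta_1)\cdots\eta_K(x;\beta_K),\qquad \eta_k(x;\beta_k)=\beta_k^\top X_k .$$ Let $\mathcal B\subseteq\mathbb R^{d_1}\times\dots\times\mathbb R^{d_K}$ be the parameter set and $\beta^*$ a point in the interior of $\mathcal B$. Let $(X_i,Y_i)_{i\ge1}$ be i.i.d., where the conditional law of $Y_i$ given $X_i=x$ is $P(\beta^*\mid x)$. Suppose that, for every $\beta\in\mathcal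 B$ and almost every $x$ under the law of $X_1$, $P(\beta\mid x)$ is a probability measure with density $f_\beta(\cdot\mid x)$ with respect to a fixed $\sigma$-finite measure $\nu$ ($f_\beta(y\mid x)$ being jointly measurable in $(x,y)$), and that, almost surely, $f_\beta(Y_1\mid X_1)>0$ for all $\beta\in\mathcal B$. Write $$\ell(\beta)=\log f_\beta(Y_1\mid X_1),\qquad \ell_n(\beta)=\frac1n\sum_{i=1}^n\log f_\beta(Y_i\mid X_i).$$ *Assumptions.* 1. $\mathcal B$ is convex and, almost surely, the log-likelihood $\ell$ is concave on $\mathcal B$. 2. The penalties $\psi_k:\mathbb R^{d_k}\to\mathbb R$ are convex. 3. $\mathbb E|\ell(\beta)|<\infty$ for all $\beta$ in a neighbourhood of $\beta^*$. Almost surely, $\ell$ is $C^2$ near $\beta^*$. Moreover $\mathbb E\|\nabla\ell(\beta^*)\|^2<\infty$ and $\mathbb E\|\nabla^2\ell(\beta^*)\|<\infty$, and the Fisher information $I(\beta^*)=-\mathbb E[\nabla^2\ell(\beta^*)]$ is positive definite. 4. The tuning parameters $\lambda_k=\lambda_{k,n}\ge0$ are deterministic and $\lambda_{k,n}\to0$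 as $n\to\infty$ for every $k$. *Conclusion.* For each $n\ge1$ let $\hat\beta=\hat\beta_n$ be, almost surely, a minimizer over $\mathcal B$ of $$\mathcal Q_n(\beta)=-\ell_n(\beta)+\sum_{k=1}^K\lambda_{k,n}\,\psi_k(\beta_k).$$ Then, as $n\to\infty$, in the Euclidean norm, $$\|\hat\beta_n-\beta^*\|=O_p\bigl(n^{-1/2}+\max_k\lambda_{k,n}\bigr),$$ i.e. for every $\varepsilon>0$ there is $C>0$ such that $\mathbb P\bigl(\|\hat\beta_n-\beta^*\|>C(n^{-1/2}+\max_k\lambda_{k,n})\bigr)\le\varepsilon$ for all sufficiently large $n$. -/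

import Mathlib

open MeasureTheory ProbabilityTheory Filter Topology

noncomputable section

namespace RegComp

/-- The space of signed measures on `Υ` with total mass one. -/
abbrev UnitMass (Υ : Type*) [MeasurableSpace Υ] : Type _ :=
  {p : SignedMeasure Υ // p Set.univ = 1}

/-- A flow: a faithful (right) action of the additive group of a real vector space `V` on the
signed measures of total mass one. -/
structure Flow (V : Type*) [AddCommGroup V] [Module ℝ V] (Υ : Type*) [MeasurableSpace Υ] where
  act : UnitMass Υ → V → UnitMass Υ
  act_zero : ∀ p, act p 0 = p
  act_act : ∀ p v w, act (act p v) w = act p (v + w)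
  faithful : ∀ v w, (∀ p, act p v = act p w) → v = w

/-- The parameter space of `β = (β₁, …, β_K)`, `β_k ∈ ℝ^{d_k}`, with the Euclidean norm. -/
abbrev Param {K : ℕ} (d : Fin K → ℕ) : Type :=
  PiLp 2 (fun k : Fin K => EuclideanSpace ℝ (Fin (d k)))

/-- A regression by composition with `K` flows. The covariate `x ∈ 𝒳` enters the `k`-th flow
through the vector `X_k = design k x`, which has `d_k` components in `V k`
(real components when `V k = ℝ`). -/
structure Model {K : ℕ} (d : Fin K → ℕ) (V : Fin K → Type*) [∀ k, AddCommGroup (V k)]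
    [∀ k, Module ℝ (V k)] (𝒳 Υ : Type*) [MeasurableSpace Υ] where
  base : UnitMass Υ
  flow : ∀ k, Flow (V k) Υ
  design : ∀ k, 𝒳 → Fin (d k) → V k

section Model

variable {K : ℕ} {d : Fin K → ℕ} {V : Fin K → Type*} [∀ k, AddCommGroup (V k)]
  [∀ k, Module ℝ (V k)] {𝒳 Υ : Type*} [MeasurableSpace Υ]

/-- The linear predictor `η_k(x; β_k) = β_kᵀ X_k`. -/
def Model.predictor (M : Model d V 𝒳 Υ) (k : Fin K) (x : 𝒳) (b : EuclideanSpace ℝ (Fin (d k))) :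
    V k :=
  ∑ j, b j • M.design k x j

/-- The composed (conditional) distribution
`P(β | x) = p₀ · η₁(x; β₁) · ⋯ · η_K(x; β_K)`. -/
def Model.dist (M : Model d V 𝒳 Υ) (β : Param d) (x : 𝒳) : UnitMass Υ :=
  Fin.foldl K (fun p k => (M.flow k).act p (M.predictor k x (β k))) M.base

variable [MeasurableSpace 𝒳]

/-- `f` is a conditional density of the model with respect to the dominating measure `ν` over the
parameter set `B`, when the covariate has law `Q`: for each `β ∈ B`, `f β` is jointly measurable
and, for almost every `x`, `P(β | x)` is nonnegative (hence a probability distribution) and has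
density `f β x`. -/
def Model.IsDensityOn (M : Model d V 𝒳 Υ) (ν : Measure Υ) (Q : Measure 𝒳) (B : Set (Param d))
    (f : Param d → 𝒳 → Υ → ℝ) : Prop :=
  ∀ β ∈ B, Measurable (Function.uncurry (f β)) ∧
    ∀ᵐ x ∂Q, 0 ≤ (M.dist β x : SignedMeasure Υ) ∧ Integrable (f β x) ν ∧
      (M.dist β x : SignedMeasure Υ) = ν.withDensityᵥ (f β x)

/-- `βs` is the true parameter of the law `D` of an observation `(X, Y)`: the conditional law of
`Y` given `X = x` is `P(βs | x)`. -/
def Model.IsTrueParam (M : Model d V 𝒳 Υ) (D : Measure (𝒳 × Υ)) (βs : Param d) : Prop :=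
  ∀ (A : Set 𝒳) (C : Set Υ), MeasurableSet A → MeasurableSet C →
    D.real (A ×ˢ C) = ∫ x in A, (M.dist βs x : SignedMeasure Υ) C ∂D.fst

end Model

section Likelihood

variable {K : ℕ} {d : Fin K → ℕ} {𝒳 Υ : Type*}

/-- The log-likelihood of one observation `z = (x, y)`. -/
def logLik (f : Param d → 𝒳 → Υ → ℝ) (z : 𝒳 × Υ) (β : Param d) : ℝ :=
  Real.log (f β z.1 z.2)

/-- The (averaged) log-likelihood `ℓ_n` of the first `n` observations. -/
def sampleLogLik (f : Param d → 𝒳 → Υ → ℝ) (z : ℕ → 𝒳 × Υ) (n : ℕ) (β : Param d) : ℝ :=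
  (n : ℝ)⁻¹ * ∑ i ∈ Finset.range n, logLik f (z i) β

/-- The penalized objective `Q_n(β) = -ℓ_n(β) + ∑ k, λ_k ψ_k(β_k)`. -/
def objective (f : Param d → 𝒳 → Υ → ℝ) (ψ : ∀ k, EuclideanSpace ℝ (Fin (d k)) → ℝ)
    (lam : Fin K → ℝ) (z : ℕ → 𝒳 × Υ) (n : ℕ) (β : Param d) : ℝ :=
  -sampleLogLik f z n β + ∑ k, lam k * ψ k (β k)

/-- The Fisher information `I(β) = -𝔼[∇² ℓ(β)]` of one observation, as a bilinear form. -/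
def fisherInfo [MeasurableSpace 𝒳] [MeasurableSpace Υ] (D : Measure (𝒳 × Υ))
    (f : Param d → 𝒳 → Υ → ℝ) (β u v : Param d) : ℝ :=
  -∫ z, iteratedFDeriv ℝ 2 (logLik f z) β ![u, v] ∂D

end Likelihood

/-- `W_n = O_p(r_n)`. -/
def IsBigOInProb {Ω : Type*} [MeasurableSpace Ω] (μ : Measure Ω) (W : ℕ → Ω → ℝ) (r : ℕ → ℝ) :
    Prop :=
  ∀ ε : ℝ, 0 < ε → ∃ C : ℝ, 0 < C ∧
    ∀ᶠ n in atTop, μ {ω | C * r n < |W n ω|} ≤ ENNReal.ofReal ε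

end RegComp

end

/-! The engine is convexity: a minimizer of a convex function lies in any ball around `βs` on whose
boundary the function exceeds its value at the centre (`ConvexOn.norm_sub_le_of_isMinOn`). So it
suffices to study the objective on one sphere, of radius a multiple of `n^{-1/2} + max λ`.

On that sphere three terms compete. The score is linear and `O_p(n^{-1/2})` by Chebyshev once it is
centred. The penalty costs at most a constant times `max λ ‖u‖`, since convex functions are locally
Lipschitz. The curvature gains a multiple of `‖u‖²`.

Two points need care. The score is centred because `βs` maximizes the expected log-likelihood
(Gibbs) and one may differentiate under the integral: concavity supplies the dominating function.
For the curvature, the Hessian is controlled only at `βs`, and the radius on which Taylor's formula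
is accurate depends on the observation. `exists_truncated_hessian` keeps the Hessian where Taylor
holds on a fixed ball and replaces it by zero elsewhere, where the tangent bound for concave
functions suffices. The truncated mean is close to `-I(βs)`, so the ordinary law of large numbers
gives a bound uniform on that ball. -/

namespace RegComp

/-! ### Gibbs' inequality for densities. -/

/-- Gibbs' inequality: the expected log-density is maximal at the true density. -/
lemma integral_log_le_of_withDensity {S : Type*} [MeasurableSpace S] {m D : Measure S}
    [IsProbabilityMeasure D] {p q : S → ℝ} (hp : Measurable p) (hq : Measurable q)
    (hD : D = m.withDensity fun z => ENNReal.ofReal (p z))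
    (hq1 : ∫⁻ z, ENNReal.ofReal (q z) ∂m ≤ 1)
    (hp0 : ∀ᵐ z ∂D, 0 < p z) (hq0 : ∀ᵐ z ∂D, 0 < q z)
    (hpi : Integrable (fun z => Real.log (p z)) D)
    (hqi : Integrable (fun z => Real.log (q z)) D) :
    ∫ z, Real.log (q z) ∂D ≤ ∫ z, Real.log (p z) ∂D := by
  have hratio : ∫⁻ z, ENNReal.ofReal (q z / p z) ∂D ≤ 1 := by
    refine le_trans ?_ hq1
    have hm : Measurable fun z => ENNReal.ofReal (q z / p z) := (hq.div hp).ennreal_ofReal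
    rw [hD, lintegral_withDensity_eq_lintegral_mul _ hp.ennreal_ofReal hm]
    refine lintegral_mono fun z => ?_
    rcases le_or_gt (p z) 0 with h | h
    · simp [ENNReal.ofReal_of_nonpos h]
    · simp only [Pi.mul_apply]
      rw [← ENNReal.ofReal_mul h.le, mul_div_cancel₀ _ h.ne']
  have hnn : 0 ≤ᵐ[D] fun z => q z / p z := by
    filter_upwards [hp0, hq0] with z h1 h2 using (div_pos h2 h1).le
  have hri : Integrable (fun z => q z / p z) D := by
    refine ⟨(hq.div hp).aestronglyMeasurable, ?_⟩
    rw [hasFiniteIntegral_iff_ofReal hnn]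
    exact hratio.trans_lt ENNReal.one_lt_top
  have hr1 : ∫ z, q z / p z ∂D ≤ 1 := by
    rw [integral_eq_lintegral_of_nonneg_ae hnn hri.1]
    exact ENNReal.toReal_le_of_le_ofReal zero_le_one (by simpa using hratio)
  -- Since `log r ≤ r - 1`, the difference of the two expectations is at most `𝔼[q/p] - 1 ≤ 0`.
  have hle : ∫ z, (Real.log (q z) - Real.log (p z)) ∂D ≤ ∫ z, (q z / p z - 1) ∂D := by
    refine integral_mono_ae (hqi.sub hpi) (hri.sub (integrable_const _)) ?_
    filter_upwards [hp0, hq0] with z h1 h2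
    rw [← Real.log_div h2.ne' h1.ne']
    exact Real.log_le_sub_one_of_pos (div_pos h2 h1)
  rw [integral_sub hqi hpi, integral_sub hri (integrable_const _)] at hle
  simp only [integral_const, probReal_univ, smul_eq_mul, mul_one] at hle
  linarith

/-! ### The joint law of an observation and its log-likelihood. -/

section Model

variable {K : ℕ} {d : Fin K → ℕ} {V : Fin K → Type*} [∀ k, AddCommGroup (V k)]
  [∀ k, Module ℝ (V k)] {𝒳 Υ : Type*} [MeasurableSpace 𝒳] [MeasurableSpace Υ]
  {M : Model d V 𝒳 Υ} {ν : Measure Υ} {B : Set (Param d)} {f : Param d → 𝒳 → Υ → ℝ}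

/-- Nonnegativity of the signed measure forces `f β x ≥ 0` only `ν`-almost everywhere; this is
enough to pass to Lebesgue integrals. -/
lemma Model.IsDensityOn.dist_apply {Q : Measure 𝒳} (h : M.IsDensityOn ν Q B f) {β : Param d}
    (hβ : β ∈ B) :
    ∀ᵐ x ∂Q, (∀ C, MeasurableSet C → ENNReal.ofReal ((M.dist β x : SignedMeasure Υ) C) =
      ∫⁻ y in C, ENNReal.ofReal (f β x y) ∂ν) ∧
      ∀ C, MeasurableSet C → 0 ≤ (M.dist β x : SignedMeasure Υ) C := by
  filter_upwards [(h β hβ).2] with x ⟨h0, hi, heq⟩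
  have hnn : ∀ C, MeasurableSet C → 0 ≤ (M.dist β x : SignedMeasure Υ) C := fun C hC => by
    simpa using VectorMeasure.le_iff.1 h0 C hC
  have hf0 : 0 ≤ᵐ[ν] f β x := by
    refine ae_nonneg_of_forall_setIntegral_nonneg hi fun C hC _ => ?_
    rw [← withDensityᵥ_apply hi hC, ← heq]
    exact hnn C hC
  refine ⟨fun C hC => ?_, hnn⟩
  rw [heq, withDensityᵥ_apply hi hC,
    ofReal_integral_eq_lintegral_ofReal hi.restrict (ae_restrict_of_ae hf0)]

lemma Model.IsDensityOn.lintegral_eq_one {Q : Measure 𝒳} [IsProbabilityMeasure Q] [SFinite ν]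
    (h : M.IsDensityOn ν Q B f) {β : Param d} (hβ : β ∈ B) :
    ∫⁻ z, ENNReal.ofReal (f β z.1 z.2) ∂(Q.prod ν) = 1 := by
  have hm : Measurable fun z : 𝒳 × Υ => ENNReal.ofReal (f β z.1 z.2) :=
    (h β hβ).1.ennreal_ofReal
  rw [lintegral_prod _ hm.aemeasurable]
  have : ∀ᵐ x ∂Q, ∫⁻ y, ENNReal.ofReal (f β x y) ∂ν = 1 := by
    filter_upwards [h.dist_apply hβ] with x hx
    have h1 := hx.1 Set.univ MeasurableSet.univ
    rw [(M.dist β x).2] at h1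
    simpa using h1.symm
  rw [lintegral_congr_ae this]
  simp

/-- Finite measures on a product are determined by rectangles. The reference measure `D.fst.prod ν`
does not depend on the parameter, so Gibbs' inequality can compare `βs` with any other `β`. -/
lemma Model.IsTrueParam.eq_withDensity {D : Measure (𝒳 × Υ)} [IsProbabilityMeasure D]
    [SFinite ν] {βs : Param d} (h : M.IsDensityOn ν D.fst B f) (ht : M.IsTrueParam D βs)
    (hβ : βs ∈ B) :
    D = (D.fst.prod ν).withDensity fun z => ENNReal.ofReal (f βs z.1 z.2) := by
  have hm : Measurable fun z : 𝒳 × Υ => ENNReal.ofReal (f βs z.1 z.2) :=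
    (h βs hβ).1.ennreal_ofReal
  refine Measure.ext_prod fun {A C} hA hC => ?_
  have hmC : Measurable fun x => ∫⁻ y in C, ENNReal.ofReal (f βs x y) ∂ν :=
    hm.lintegral_prod_right' (ν := ν.restrict C)
  have hae : ∀ᵐ x ∂D.fst.restrict A, (M.dist βs x : SignedMeasure Υ) C =
      (∫⁻ y in C, ENNReal.ofReal (f βs x y) ∂ν).toReal := by
    filter_upwards [ae_restrict_of_ae (h.dist_apply hβ)] with x hx
    rw [← hx.1 C hC, ENNReal.toReal_ofReal (hx.2 C hC)]
  have hfin : ∀ᵐ x ∂D.fst.restrict A, ∫⁻ y in C, ENNReal.ofReal (f βs x y) ∂ν < ⊤ := by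
    filter_upwards [ae_restrict_of_ae (h.dist_apply hβ)] with x hx
    rw [← hx.1 C hC]
    exact ENNReal.ofReal_lt_top
  have hle : ∫⁻ x in A, ∫⁻ y in C, ENNReal.ofReal (f βs x y) ∂ν ∂D.fst ≠ ⊤ := by
    refine ((lintegral_mono' Measure.restrict_le_self fun x =>
      lintegral_mono' Measure.restrict_le_self le_rfl).trans_lt ?_).ne
    · rw [← lintegral_prod _ hm.aemeasurable, h.lintegral_eq_one hβ]
      exact ENNReal.one_lt_top
  have h1 := ht A C hA hC
  rw [integral_congr_ae hae, integral_toReal hmC.aemeasurable hfin] at h1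
  rw [withDensity_apply _ (hA.prod hC), ← Measure.prod_restrict,
    lintegral_prod _ hm.aemeasurable]
  exact (ENNReal.toReal_eq_toReal_iff' (measure_ne_top _ _) hle).1 h1

/-- The expected log-likelihood is maximal at the true parameter. -/
lemma integral_logLik_le {D : Measure (𝒳 × Υ)} [IsProbabilityMeasure D]
    [SFinite ν] {βs : Param d} (h : M.IsDensityOn ν D.fst B f) (ht : M.IsTrueParam D βs)
    (hpos : ∀ᵐ z ∂D, ∀ β ∈ B, 0 < f β z.1 z.2) (hs : βs ∈ B) {β : Param d} (hβ : β ∈ B)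
    (his : Integrable (fun z => logLik f z βs) D) (hi : Integrable (fun z => logLik f z β) D) :
    ∫ z, logLik f z β ∂D ≤ ∫ z, logLik f z βs ∂D :=
  integral_log_le_of_withDensity (m := D.fst.prod ν) (h βs hs).1 (h β hβ).1
    (ht.eq_withDensity h hs) (h.lintegral_eq_one hβ).le (hpos.mono fun _ hz => hz βs hs)
    (hpos.mono fun _ hz => hz β hβ) his hi

end Model

/-! ### Concave functions: tangents, mean-zero score, Taylor expansion. -/

section Concave

variable {E : Type*} [NormedAddCommGroup E] [NormedSpace ℝ E]

lemma tendsto_inv_smul_sub {φ : E → ℝ} {x u : E} (h : DifferentiableAt ℝ φ x) {t : ℕ → ℝ}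
    (ht : Tendsto t atTop (𝓝 0)) (ht0 : ∀ n, 0 < t n) :
    Tendsto (fun n => (t n)⁻¹ * (φ (x + t n • u) - φ x)) atTop (𝓝 (fderiv ℝ φ x u)) := by
  have h1 := (h.hasFDerivAt.hasLineDerivAt u).tendsto_slope_zero
  exact h1.comp (tendsto_nhdsWithin_iff.2 ⟨ht, .of_forall fun n => (ht0 n).ne'⟩)

/-- Slopes along a ray decrease with the step length. This is the lower half of the domination used
for the score. -/
lemma _root_.ConcaveOn.sub_le_inv_mul_sub {B : Set E} {φ : E → ℝ} (hφ : ConcaveOn ℝ B φ) {x u : E}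
    (hx : x ∈ B) (hu : x + u ∈ B) {t : ℝ} (ht0 : 0 < t) (ht1 : t ≤ 1) :
    φ (x + u) - φ x ≤ t⁻¹ * (φ (x + t • u) - φ x) := by
  have h := hφ.2 hx hu (sub_nonneg.2 ht1) ht0.le (by ring)
  rw [show (1 - t) • x + t • (x + u) = x + t • u by module] at h
  simp only [smul_eq_mul] at h
  rw [← div_eq_inv_mul, le_div_iff₀ ht0]
  linarith

lemma tendsto_one_div_succ : Tendsto (fun n : ℕ => 1 / ((n : ℝ) + 1)) atTop (𝓝 0) :=
  tendsto_one_div_add_atTop_nhds_zero_nat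

/-- A concave function lies below its tangent. -/
lemma _root_.ConcaveOn.sub_le_fderiv {B : Set E} {φ : E → ℝ} (hφ : ConcaveOn ℝ B φ) {x u : E}
    (hx : x ∈ B) (hu : x + u ∈ B) (h : DifferentiableAt ℝ φ x) :
    φ (x + u) - φ x ≤ fderiv ℝ φ x u :=
  ge_of_tendsto' (tendsto_inv_smul_sub h tendsto_one_div_succ fun _ => Nat.one_div_pos_of_nat)
    fun n => hφ.sub_le_inv_mul_sub hx hu Nat.one_div_pos_of_nat (by
      rw [div_le_one (by positivity)]; linarith [n.cast_nonneg (α := ℝ)])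

variable {S : Type*} [MeasurableSpace S] {D : Measure S}

/-- The score of a concave log-likelihood has mean zero at a maximizer of its expectation. -/
lemma integral_fderiv_apply_eq_zero {ℓ : S → E → ℝ} {B : Set E} {x : E} (hx : x ∈ interior B)
    (hconc : ∀ᵐ z ∂D, ConcaveOn ℝ B (ℓ z)) (hdiff : ∀ᵐ z ∂D, DifferentiableAt ℝ (ℓ z) x)
    (hint : ∀ᶠ β in 𝓝 x, Integrable (fun z => ℓ z β) D)
    (hmax : ∀ᶠ β in 𝓝 x, ∫ z, ℓ z β ∂D ≤ ∫ z, ℓ z x ∂D)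
    (hscore : Integrable (fun z => fderiv ℝ (ℓ z) x) D) (u : E) :
    ∫ z, fderiv ℝ (ℓ z) x u ∂D = 0 := by
  -- Linearity turns this one-sided bound, used at `u` and `-u`, into an equality.
  have key : ∀ v : E, ∫ z, fderiv ℝ (ℓ z) x v ∂D ≤ 0 := by
    intro v
    have hcont : Tendsto (fun t : ℝ => x + t • v) (𝓝[>] 0) (𝓝 x) := by
      have : ContinuousAt (fun t : ℝ => x + t • v) 0 := by fun_prop
      simpa [ContinuousAt] using this.mono_left nhdsWithin_le_nhds
    obtain ⟨r, hr, hball⟩ : ∃ r > 0, ∀ t ∈ Set.Ioc (0 : ℝ) r,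
        x + t • v ∈ B ∧ Integrable (fun z => ℓ z (x + t • v)) D ∧
          ∫ z, ℓ z (x + t • v) ∂D ≤ ∫ z, ℓ z x ∂D := by
      have hB : ∀ᶠ y in 𝓝 x, y ∈ B := mem_interior_iff_mem_nhds.1 hx
      have := hcont.eventually (hB.and (hint.and hmax))
      exact mem_nhdsGT_iff_exists_Ioc_subset.1 this
    have hix := hint.self_of_nhds
    have hs : ∀ n : ℕ, 0 < 1 / ((n : ℝ) + 1) ∧ 1 / ((n : ℝ) + 1) ≤ 1 := fun n =>
      ⟨Nat.one_div_pos_of_nat, by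
        rw [div_le_one (by positivity)]; linarith [n.cast_nonneg (α := ℝ)]⟩
    set t : ℕ → ℝ := fun n => 1 / ((n : ℝ) + 1) with ht
    have hmem : ∀ n, t n * r ∈ Set.Ioc 0 r := fun n =>
      ⟨mul_pos (hs n).1 hr, mul_le_of_le_one_left hr.le (hs n).2⟩
    have htend : Tendsto (fun n => ∫ z, (t n)⁻¹ * (ℓ z (x + t n • r • v) - ℓ z x) ∂D) atTop
        (𝓝 (∫ z, fderiv ℝ (ℓ z) x (r • v) ∂D)) := by
      have hir := (hball r ⟨hr, le_rfl⟩).2.1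
      have hin : ∀ n, Integrable (fun z => (t n)⁻¹ * (ℓ z (x + t n • r • v) - ℓ z x)) D := by
        intro n
        have := (hball _ (hmem n)).2.1
        rw [← smul_smul] at this
        exact (this.sub hix).const_mul _
      -- Concavity traps every slope between the full-step increment and the directional derivative,
      -- both integrable.
      refine tendsto_integral_of_dominated_convergence
        (fun z => |ℓ z (x + r • v) - ℓ z x| + ‖fderiv ℝ (ℓ z) x (r • v)‖)
        (fun n => (hin n).1) ?_ ?_ ?_
      · exact (hir.sub hix).abs.add (hscore.apply_continuousLinearMap _).norm
      · intro n
        filter_upwards [hconc, hdiff] with z hc hd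
        have h1 := hc.sub_le_inv_mul_sub (interior_subset hx) (hball r ⟨hr, le_rfl⟩).1
          (hs n).1 (hs n).2
        have hm := (hball _ (hmem n)).1
        rw [← smul_smul] at hm
        have h2 := hc.sub_le_fderiv (interior_subset hx) hm hd
        rw [map_smul, smul_eq_mul] at h2
        have h3 : (t n)⁻¹ * (ℓ z (x + t n • r • v) - ℓ z x) ≤ fderiv ℝ (ℓ z) x (r • v) := by
          rwa [← div_eq_inv_mul, div_le_iff₀' (hs n).1]
        rw [Real.norm_eq_abs, Real.norm_eq_abs]
        refine abs_le.2 ⟨?_, ?_⟩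
        · linarith [neg_abs_le (ℓ z (x + r • v) - ℓ z x), abs_nonneg (fderiv ℝ (ℓ z) x (r • v))]
        · linarith [le_abs_self (fderiv ℝ (ℓ z) x (r • v)), abs_nonneg (ℓ z (x + r • v) - ℓ z x)]
      · filter_upwards [hdiff] with z hd
        exact tendsto_inv_smul_sub hd tendsto_one_div_succ fun n => (hs n).1
    have hle : ∫ z, fderiv ℝ (ℓ z) x (r • v) ∂D ≤ 0 := by
      refine le_of_tendsto' htend fun n => ?_
      have hm := (hball _ (hmem n)).2
      rw [← smul_smul] at hm
      rw [integral_const_mul, integral_sub hm.1 hix]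
      exact mul_nonpos_of_nonneg_of_nonpos (inv_nonneg.2 (hs n).1.le) (sub_nonpos.2 hm.2)
    simp only [map_smul, smul_eq_mul, integral_const_mul] at hle
    exact nonpos_of_mul_nonpos_right hle hr
  refine le_antisymm (key u) ?_
  have := key (-u)
  simp only [map_neg, integral_neg] at this
  linarith

/-- Second-order Taylor expansion with a quadratic error. -/
lemma _root_.ContDiffAt.exists_abs_taylor_two_le {φ : E → ℝ} {x : E} (h : ContDiffAt ℝ 2 φ x)
    {ε : ℝ} (hε : 0 < ε) :
    ∃ δ > 0, ∀ u : E, ‖u‖ ≤ δ →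
      |φ (x + u) - φ x - fderiv ℝ φ x u - 1 / 2 * iteratedFDeriv ℝ 2 φ x ![u, u]|
        ≤ ε * ‖u‖ ^ 2 := by
  have h1 : ∀ᶠ y in 𝓝 x, DifferentiableAt ℝ φ y :=
    (h.eventually (by simp)).mono fun y hy => hy.differentiableAt (by simp)
  have h2 : HasFDerivAt (fderiv ℝ φ) (fderiv ℝ (fderiv ℝ φ) x) x :=
    ((h.fderiv_right (m := 1) (by norm_num)).differentiableAt (by simp)).hasFDerivAt
  have h3 := (hasFDerivAt_iff_isLittleO.1 h2).def hε
  obtain ⟨δ, hδ, hball⟩ := Metric.nhds_basis_closedBall.eventually_iff.1 (h1.and h3)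
  refine ⟨δ, hδ, fun u hu => ?_⟩
  set L := fderiv ℝ (fderiv ℝ φ) x
  have hmem : ∀ t ∈ Set.Icc (0 : ℝ) 1, x + t • u ∈ Metric.closedBall x δ := fun t ht => by
    rw [mem_closedBall_iff_norm, add_sub_cancel_left, norm_smul, Real.norm_eq_abs,
      abs_of_nonneg ht.1]
    exact (mul_le_of_le_one_left (norm_nonneg _) ht.2).trans hu
  -- The Taylor remainder along the segment, up to a constant; its derivative is small because the
  -- gradient is differentiable at `x`.
  set ψ : ℝ → ℝ := fun t => φ (x + t • u) - t * fderiv ℝ φ x u - 1 / 2 * t ^ 2 * L u u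
  have hψ : ∀ t ∈ Set.Icc (0 : ℝ) 1, HasDerivWithinAt ψ
      (fderiv ℝ φ (x + t • u) u - fderiv ℝ φ x u - t * L u u) (Set.Icc 0 1) t := by
    intro t ht
    have hl : HasDerivAt (fun t : ℝ => x + t • u) u t := by
      simpa using ((hasDerivAt_id t).smul_const u).const_add x
    have ha := (hball (hmem t ht)).1.hasFDerivAt.comp_hasDerivAt t hl
    have hb : HasDerivAt (fun t : ℝ => t * fderiv ℝ φ x u) (fderiv ℝ φ x u) t := by
      simpa using (hasDerivAt_id t).mul_const (fderiv ℝ φ x u)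
    have hc : HasDerivAt (fun t : ℝ => 1 / 2 * t ^ 2 * L u u) (t * L u u) t := by
      convert! (((hasDerivAt_id t).pow 2).const_mul (1 / 2)).mul_const (L u u) using 1
      simp
    exact ((ha.sub hb).sub hc).hasDerivWithinAt
  have hbound : ∀ t ∈ Set.Ico (0 : ℝ) 1,
      ‖fderiv ℝ φ (x + t • u) u - fderiv ℝ φ x u - t * L u u‖ ≤ ε * ‖u‖ ^ 2 := by
    intro t ht
    have ht' := Set.Ico_subset_Icc_self ht
    have ha := (hball (hmem t ht')).2
    rw [add_sub_cancel_left, map_smul] at ha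
    calc ‖fderiv ℝ φ (x + t • u) u - fderiv ℝ φ x u - t * L u u‖
        = ‖(fderiv ℝ φ (x + t • u) - fderiv ℝ φ x - t • L u) u‖ := by simp
      _ ≤ ‖fderiv ℝ φ (x + t • u) - fderiv ℝ φ x - t • L u‖ * ‖u‖ :=
          ContinuousLinearMap.le_opNorm _ _
      _ ≤ ε * ‖t • u‖ * ‖u‖ := by gcongr
      _ ≤ ε * ‖u‖ * ‖u‖ := by
          gcongr
          rw [norm_smul, Real.norm_eq_abs, abs_of_nonneg ht.1]
          exact mul_le_of_le_one_left (norm_nonneg _) ht'.2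
      _ = ε * ‖u‖ ^ 2 := by ring
  have := norm_image_sub_le_of_norm_deriv_le_segment_01' hψ hbound
  rw [iteratedFDeriv_two_apply]
  convert! this using 1
  simp only [ψ, Real.norm_eq_abs]
  congr 1
  simp [L]
  ring

end Concave

/-! ### Uniform curvature and the truncated Hessian. -/

section Curvature

variable {E : Type*} [NormedAddCommGroup E] [NormedSpace ℝ E] [FiniteDimensional ℝ E]

/-- A quadratic form that is negative away from zero is uniformly negative. -/
lemma exists_quadratic_le_neg (Q : E [×2]→L[ℝ] ℝ) (hQ : ∀ u, u ≠ 0 → Q ![u, u] < 0) :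
    ∃ c > 0, ∀ u, Q ![u, u] ≤ -c * ‖u‖ ^ 2 := by
  have hsmul : ∀ (t : ℝ) (u : E), Q ![t • u, t • u] = t ^ 2 * Q ![u, u] := fun t u => by
    have := Q.map_smul_univ (fun _ => t) ![u, u]
    simp only [Finset.prod_const, Finset.card_univ, Fintype.card_fin, smul_eq_mul] at this
    rw [← this]
    congr 1
    ext i
    fin_cases i <;> rfl
  have hcont : Continuous fun u : E => Q ![u, u] := by fun_prop
  -- The unit sphere is empty exactly when `E` is trivial; otherwise `-c` is the maximum of the form
  -- on it.
  rcases (Metric.sphere (0 : E) 1).eq_empty_or_nonempty with he | hne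
  · have hz : ∀ u : E, u = 0 := fun u => by
      by_contra hu
      have : (‖u‖⁻¹ • u) ∈ Metric.sphere (0 : E) 1 := by simp [norm_smul, hu]
      rwa [he] at this
    refine ⟨1, one_pos, fun u => ?_⟩
    have := hsmul 0 u
    simp_all
  · obtain ⟨w, hw, hmax⟩ := (isCompact_sphere (0 : E) 1).exists_isMaxOn hne hcont.continuousOn
    have hw0 : w ≠ 0 := by
      rintro rfl
      simp at hw
    refine ⟨-Q ![w, w], neg_pos.2 (hQ w hw0), fun u => ?_⟩
    rcases eq_or_ne u 0 with rfl | hu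
    · have := hsmul 0 (0 : E)
      simp_all
    · have hmem : (‖u‖⁻¹ • u) ∈ Metric.sphere (0 : E) 1 := by simp [norm_smul, hu]
      have h1 : Q ![‖u‖⁻¹ • u, ‖u‖⁻¹ • u] ≤ Q ![w, w] := hmax hmem
      rw [hsmul, inv_pow, inv_mul_le_iff₀ (by positivity)] at h1
      linarith

variable {S : Type*} [MeasurableSpace S] {D : Measure S}

/-- Up to a small error, a concave random function with an integrable Hessian is bounded above,
uniformly on a fixed ball, by a quadratic expansion with an integrable random quadratic form. -/
lemma exists_truncated_hessian {ℓ : S → E → ℝ} {B : Set E} {x : E} (hx : x ∈ interior B)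
    (hconc : ∀ᵐ z ∂D, ConcaveOn ℝ B (ℓ z)) (hsmooth : ∀ᵐ z ∂D, ContDiffAt ℝ 2 (ℓ z) x)
    (hmeas : ∀ᶠ β in 𝓝 x, AEMeasurable (fun z => ℓ z β) D)
    (hscore : AEStronglyMeasurable (fun z => fderiv ℝ (ℓ z) x) D)
    (hhess : Integrable (fun z => iteratedFDeriv ℝ 2 (ℓ z) x) D) {ε : ℝ} (hε : 0 < ε) :
    ∃ δ > 0, ∃ W : S → E [×2]→L[ℝ] ℝ, StronglyMeasurable W ∧ Integrable W D ∧
      ‖∫ z, W z ∂D - ∫ z, iteratedFDeriv ℝ 2 (ℓ z) x ∂D‖ ≤ ε ∧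
      ∀ᵐ z ∂D, ∀ u, ‖u‖ ≤ δ →
        ℓ z (x + u) - ℓ z x ≤ fderiv ℝ (ℓ z) x u + 1 / 2 * W z ![u, u] + ε * ‖u‖ ^ 2 := by
  obtain ⟨ρ, hρ, hball⟩ : ∃ ρ > 0, ∀ u : E, ‖u‖ < ρ →
      x + u ∈ interior B ∧ AEMeasurable (fun z => ℓ z (x + u)) D := by
    obtain ⟨ρ, hρ, h⟩ := Metric.eventually_nhds_iff_ball.1
      ((isOpen_interior.eventually_mem hx).and hmeas)
    exact ⟨ρ, hρ, fun u hu => h _ (by simpa [mem_ball_iff_norm] using hu)⟩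
  obtain ⟨s, hsc, hsd⟩ := TopologicalSpace.exists_countable_dense E
  set r : ℕ → ℝ := fun m => ρ * (1 / ((m : ℝ) + 1)) with hr
  have hr0 : ∀ m, 0 < r m := fun m => mul_pos hρ Nat.one_div_pos_of_nat
  have hrρ : ∀ m, r m ≤ ρ := fun m => mul_le_of_le_one_right hρ.le (by
    rw [div_le_one (by positivity)]; linarith [m.cast_nonneg (α := ℝ)])
  have hrt : Tendsto r atTop (𝓝 0) := by
    simpa only [mul_zero] using tendsto_one_div_succ.const_mul ρ
  -- The observations whose Taylor upper bound holds on the ball of radius `r m`. Restricting to a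
  -- countable dense set of `u` makes this event measurable.
  set A : ℕ → Set S := fun m => ⋂ u ∈ s ∩ Metric.ball 0 (r m), {z | ℓ z (x + u) ≤
    ℓ z x + fderiv ℝ (ℓ z) x u + 1 / 2 * iteratedFDeriv ℝ 2 (ℓ z) x ![u, u] + ε * ‖u‖ ^ 2} with hA
  have hAmeas : ∀ m, NullMeasurableSet (A m) D := by
    intro m
    refine NullMeasurableSet.biInter (hsc.mono Set.inter_subset_left) fun u hu => ?_
    have hu' : ‖u‖ < ρ := (mem_ball_zero_iff.1 hu.2).trans_le (hrρ m)
    have h0 : AEMeasurable (fun z => ℓ z x) D := by simpa using (hball 0 (by simpa using hρ)).2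
    have h1 : AEMeasurable (fun z => fderiv ℝ (ℓ z) x u) D :=
      (hscore.apply_continuousLinearMap u).aemeasurable
    have h2 : AEMeasurable (fun z => iteratedFDeriv ℝ 2 (ℓ z) x ![u, u]) D :=
      ((ContinuousMultilinearMap.apply ℝ (fun _ : Fin 2 => E) ℝ
        ![u, u]).continuous.comp_aestronglyMeasurable hhess.1).aemeasurable
    exact nullMeasurableSet_le (hball u hu').2
      (((h0.add h1).add (h2.const_mul _)).add_const _)
  have hAfull : ∀ᵐ z ∂D, ∀ᶠ m in atTop, z ∈ A m := by
    filter_upwards [hsmooth] with z hz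
    obtain ⟨δ, hδ, hle⟩ := hz.exists_abs_taylor_two_le hε
    filter_upwards [hrt.eventually_lt_const hδ] with m hm
    refine Set.mem_iInter₂.2 fun u hu => ?_
    have := (abs_le.1 (hle u ((mem_ball_zero_iff.1 hu.2).trans hm).le)).2
    simp only [Set.mem_ofPred_eq]
    linarith
  have hlim : Tendsto (fun m => ∫ z, (A m).indicator (fun z => iteratedFDeriv ℝ 2 (ℓ z) x) z ∂D)
      atTop (𝓝 (∫ z, iteratedFDeriv ℝ 2 (ℓ z) x ∂D)) := by
    refine tendsto_integral_of_dominated_convergence _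
      (fun m => hhess.1.indicator₀ (hAmeas m)) hhess.norm
      (fun m => .of_forall fun z => norm_indicator_le_norm_self _ _) ?_
    filter_upwards [hAfull] with z hz
    refine tendsto_const_nhds.congr' ?_
    filter_upwards [hz] with m hm
    rw [Set.indicator_of_mem hm]
  obtain ⟨m, hm⟩ := (Metric.tendsto_nhds.1 hlim ε hε).exists
  have hWm := hhess.1.indicator₀ (hAmeas m)
  -- Half the radius keeps the closed ball inside the open one. A strongly measurable version of the
  -- truncated Hessian can be composed with the sample.
  refine ⟨r m / 2, half_pos (hr0 m), hWm.mk _, hWm.stronglyMeasurable_mk,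
    hhess.mono hWm.stronglyMeasurable_mk.aestronglyMeasurable ?_, ?_, ?_⟩
  · filter_upwards [hWm.ae_eq_mk] with z hz
    rw [← hz]
    exact norm_indicator_le_norm_self _ _
  · rw [← integral_congr_ae hWm.ae_eq_mk, ← dist_eq_norm]
    exact hm.le
  · filter_upwards [hWm.ae_eq_mk, hconc, hsmooth] with z hz hc hd u hu
    have hum : ‖u‖ < r m := by linarith [hr0 m]
    rw [← hz]
    by_cases hzA : z ∈ A m
    · rw [Set.indicator_of_mem hzA]
      set g : E → ℝ := fun u => fderiv ℝ (ℓ z) x u +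
        1 / 2 * iteratedFDeriv ℝ 2 (ℓ z) x ![u, u] + ε * ‖u‖ ^ 2
      have hg : Continuous g := by fun_prop
      -- Both sides are continuous, so the bound extends from the dense set to the ball.
      have hcl : u ∈ closure (Metric.ball 0 (r m) ∩ s) :=
        hsd.open_subset_closure_inter Metric.isOpen_ball (mem_ball_zero_iff.2 hum)
      have hφ : ContinuousAt (fun v => ℓ z (x + v) - ℓ z x) u := by
        have h1 : ContinuousAt (ℓ z) (x + u) := hc.continuousOn_interior.continuousAt
          (isOpen_interior.mem_nhds (hball u (hum.trans_le (hrρ m))).1)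
        have h2 : ContinuousAt (fun v => x + v) u := by fun_prop
        exact (ContinuousAt.comp (f := fun v => x + v) h1 h2).sub continuousAt_const
      have hne := mem_closure_iff_nhdsWithin_neBot.1 hcl
      refine le_of_tendsto_of_tendsto (b := 𝓝[Metric.ball 0 (r m) ∩ s] u) (hφ.mono_left nhdsWithin_le_nhds)
        (hg.continuousAt.mono_left nhdsWithin_le_nhds)
        (eventually_nhdsWithin_of_forall fun v hv => ?_)
      have : ℓ z (x + v) ≤ _ := Set.mem_iInter₂.1 hzA v ⟨hv.2, hv.1⟩
      simp only [g]
      linarith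
    · rw [Set.indicator_of_notMem hzA]
      -- Off `A m` the form is zero, and the tangent inequality is already the claim.
      have := hc.sub_le_fderiv (interior_subset hx)
        (interior_subset (hball u (hum.trans_le (hrρ m))).1) (hd.differentiableAt (by simp))
      have h2 : 0 ≤ ε * ‖u‖ ^ 2 := by positivity
      simp only [zero_apply]
      linarith

end Curvature

/-! ### Averages of i.i.d. observations. -/

section IID

variable {Ω S : Type*} [MeasurableSpace Ω] [MeasurableSpace S] {μ : Measure Ω}
  [IsProbabilityMeasure μ] {D : Measure S} {Z : ℕ → Ω → S}

/-- The weak law of large numbers for a function of i.i.d. observations. -/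
lemma eventually_measure_average_le {F : Type*} [NormedAddCommGroup F] [NormedSpace ℝ F]
    [CompleteSpace F] (hZm : ∀ i, Measurable (Z i)) (hZl : ∀ i, μ.map (Z i) = D)
    (hZi : iIndepFun Z μ) {W : S → F} (hWm : StronglyMeasurable W) (hW : Integrable W D)
    {η : ℝ} (hη : 0 < η) {ε : ENNReal} (hε : 0 < ε) :
    ∀ᶠ n : ℕ in atTop,
      μ {ω | η ≤ ‖(n : ℝ)⁻¹ • ∑ i ∈ Finset.range n, W (Z i ω) - ∫ z, W z ∂D‖} ≤ ε := by
  borelize F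
  have hident : ∀ i, IdentDistrib (W ∘ Z i) (W ∘ Z 0) μ μ := fun i =>
    IdentDistrib.comp ⟨(hZm i).aemeasurable, (hZm 0).aemeasurable, by rw [hZl, hZl]⟩ hWm.measurable
  have hint : Integrable (W ∘ Z 0) μ := by
    rw [← integrable_map_measure (by rw [hZl]; exact hW.1) (hZm 0).aemeasurable, hZl]
    exact hW
  have hlaw := strong_law_ae (fun i => W ∘ Z i) hint
    (fun i j hij => (hZi.comp (fun _ => W) fun _ => hWm.measurable).indepFun hij) hident
  have hmean : μ[W ∘ Z 0] = ∫ z, W z ∂D := by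
    rw [← hZl 0, integral_map (hZm 0).aemeasurable (by rw [hZl]; exact hW.1)]
    rfl
  rw [hmean] at hlaw
  have hprob := tendstoInMeasure_of_tendsto_ae (fun n => ?_) hlaw
  · exact ((tendstoInMeasure_iff_norm.1 hprob η hη).eventually_lt_const hε).mono
      fun n hn => hn.le
  · refine StronglyMeasurable.aestronglyMeasurable ?_
    exact (Finset.stronglyMeasurable_fun_sum _
      fun i _ => hWm.comp_measurable (hZm i)).const_smul _

/-- Chebyshev's inequality for an average of centred i.i.d. observations. -/
lemma measure_average_ge_le (hZm : ∀ i, Measurable (Z i)) (hZl : ∀ i, μ.map (Z i) = D)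
    (hZi : iIndepFun Z μ) {Y : S → ℝ} (hY : MemLp Y 2 D) (h0 : ∫ z, Y z ∂D = 0) {T : ℝ}
    (hT : 0 < T) {n : ℕ} (hn : 1 ≤ n) :
    μ {ω | T * (√n)⁻¹ ≤ |(n : ℝ)⁻¹ * ∑ i ∈ Finset.range n, Y (Z i ω)|} ≤
      ENNReal.ofReal (Var[Y; D] / T ^ 2) := by
  have hn0 : (0 : ℝ) < n := by exact_mod_cast hn
  have hYi : ∀ i, MemLp (Y ∘ Z i) 2 μ := fun i => by
    rw [← memLp_map_measure_iff (by rw [hZl]; exact hY.1) (hZm i).aemeasurable, hZl]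
    exact hY
  have hind : iIndepFun (fun i => Y ∘ Z i) μ :=
    hZi.comp₀ (fun _ => Y) (fun i => (hZm i).aemeasurable) fun i => by
      rw [hZl]; exact hY.1.aemeasurable
  have hvar : Var[∑ i ∈ Finset.range n, Y ∘ Z i; μ] = n * Var[Y; D] := by
    rw [IndepFun.variance_sum (fun i _ => hYi i) fun i _ j _ hij => hind.indepFun hij]
    have : ∀ i, Var[Y ∘ Z i; μ] = Var[Y; D] := fun i => by
      rw [← variance_map (by rw [hZl]; exact hY.1.aemeasurable) (hZm i).aemeasurable, hZl]
    simp [this]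
  have hmean : ∫ ω, (∑ i ∈ Finset.range n, Y ∘ Z i) ω ∂μ = 0 := by
    simp only [Finset.sum_apply]
    rw [integral_finsetSum _ fun i _ => (hYi i).integrable (by norm_num)]
    refine Finset.sum_eq_zero fun i _ => ?_
    rw [← h0, ← hZl i, integral_map (hZm i).aemeasurable (by rw [hZl]; exact hY.1)]
    rfl
  have hs : 0 < T * √n := by positivity
  have hcheb := meas_ge_le_variance_div_sq (memLp_finsetSum' (Finset.range n) fun i _ => hYi i) hs
  rw [hmean, hvar, mul_pow, Real.sq_sqrt hn0.le, mul_comm (n : ℝ),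
    mul_div_mul_right _ _ hn0.ne'] at hcheb
  refine le_trans (measure_mono fun ω hω => ?_) hcheb
  simp only [Set.mem_ofPred_eq, sub_zero, Finset.sum_apply, Function.comp_apply] at hω ⊢
  rw [abs_mul, abs_of_pos (inv_pos.2 hn0), ← div_eq_inv_mul, le_div_iff₀ hn0] at hω
  refine le_trans (le_of_eq ?_) hω
  have : √(n : ℝ) ≠ 0 := by positivity
  field_simp
  rw [Real.sq_sqrt hn0.le]

/-- An average of centred square-integrable i.i.d. linear forms is `O_p(n^{-1/2})`. -/
lemma exists_measure_average_le {E : Type*} [NormedAddCommGroup E] [NormedSpace ℝ E]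
    [FiniteDimensional ℝ E] (hZm : ∀ i, Measurable (Z i)) (hZl : ∀ i, μ.map (Z i) = D)
    (hZi : iIndepFun Z μ) {g : S → E →L[ℝ] ℝ} (hg : MemLp g 2 D)
    (h0 : ∀ u, ∫ z, g z u ∂D = 0) {ε : ℝ} (hε : 0 < ε) :
    ∃ T > 0, ∀ n : ℕ, 1 ≤ n →
      μ {ω | T * (√n)⁻¹ < ‖(n : ℝ)⁻¹ • ∑ i ∈ Finset.range n, g (Z i ω)‖} ≤ ENNReal.ofReal ε := by
  set b := Module.finBasis ℝ E
  obtain ⟨C, hC, hop⟩ := b.exists_opNorm_le (F := ℝ)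
  have hY : ∀ j, MemLp (fun z => g z (b j)) 2 D := fun j =>
    (ContinuousLinearMap.apply ℝ ℝ (b j)).comp_memLp' hg
  set v : ℝ := ∑ j, Var[fun z => g z (b j); D]
  have hv : 0 ≤ v := Finset.sum_nonneg fun j _ => variance_nonneg _ _
  -- Chosen so that `v / T² ≤ ε`; the `+ 1` keeps `T` positive when every variance vanishes.
  set T := √((v + 1) / ε)
  have hT : 0 < T := by positivity
  refine ⟨C * T, by positivity, fun n hn => ?_⟩
  -- A linear form is controlled by its values on a basis, so a union bound over coordinates
  -- suffices.
  have hsub : {ω | C * T * (√n)⁻¹ < ‖(n : ℝ)⁻¹ • ∑ i ∈ Finset.range n, g (Z i ω)‖} ⊆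
      ⋃ j, {ω | T * (√n)⁻¹ ≤ |(n : ℝ)⁻¹ * ∑ i ∈ Finset.range n, g (Z i ω) (b j)|} := by
    intro ω hω
    by_contra hcon
    simp only [Set.mem_iUnion, Set.mem_ofPred_eq, not_exists, not_le] at hcon hω
    refine hω.not_ge ?_
    rw [mul_assoc]
    refine hop (by positivity) fun j => ?_
    simpa using (hcon j).le
  calc μ _ ≤ ∑ j, μ {ω | T * (√n)⁻¹ ≤ |(n : ℝ)⁻¹ * ∑ i ∈ Finset.range n, g (Z i ω) (b j)|} :=
        (measure_mono hsub).trans (measure_iUnion_fintype_le _ _)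
    _ ≤ ∑ j, ENNReal.ofReal (Var[fun z => g z (b j); D] / T ^ 2) :=
        Finset.sum_le_sum fun j _ => measure_average_ge_le hZm hZl hZi (hY j) (h0 _) hT hn
    _ = ENNReal.ofReal (v / T ^ 2) := by
        rw [← ENNReal.ofReal_sum_of_nonneg fun j _ =>
          div_nonneg (variance_nonneg _ _) (sq_nonneg _), Finset.sum_div]
    _ ≤ ENNReal.ofReal ε := by
        refine ENNReal.ofReal_le_ofReal ?_
        rw [Real.sq_sqrt (by positivity), div_le_iff₀ (by positivity)]
        field_simp
        linarith

end IID

/-! ### Convexity, localization and growth of the penalized objective. -/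

lemma convexOn_finset_sum {E ι : Type*} [AddCommGroup E] [Module ℝ E] {B : Set E}
    (hB : Convex ℝ B) (s : Finset ι) {φ : ι → E → ℝ} (h : ∀ i ∈ s, ConvexOn ℝ B (φ i)) :
    ConvexOn ℝ B fun x => ∑ i ∈ s, φ i x := by
  classical
  induction s using Finset.induction_on with
  | empty => simpa using convexOn_const (0 : ℝ) hB
  | insert i s hi ih =>
    simp only [Finset.sum_insert hi]
    exact (h i (Finset.mem_insert_self i s)).add
      (ih fun j hj => h j (Finset.mem_insert_of_mem hj))

/-- A minimizer of a convex function lies in every ball on whose boundary the function exceeds its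
value at the centre. -/
lemma _root_.ConvexOn.norm_sub_le_of_isMinOn {E : Type*} [NormedAddCommGroup E] [NormedSpace ℝ E]
    {B : Set E} {φ : E → ℝ} (hφ : ConvexOn ℝ B φ) {x b : E} (hx : x ∈ B) (hb : b ∈ B)
    (hmin : IsMinOn φ B b) {R : ℝ} (hR : 0 < R) (h : ∀ u, ‖u‖ = R → φ x < φ (x + u)) :
    ‖b - x‖ ≤ R := by
  by_contra! hcon
  have hpos : 0 < ‖b - x‖ := hR.trans hcon
  -- The segment from `x` to `b` crosses the sphere at this parameter; convexity bounds the value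
  -- there by `φ x`.
  set s := R / ‖b - x‖
  have hs0 : 0 ≤ s := by positivity
  have hs1 : s ≤ 1 := (div_le_one hpos).2 hcon.le
  have hn : ‖s • (b - x)‖ = R := by
    rw [norm_smul, Real.norm_eq_abs, abs_of_nonneg hs0, div_mul_cancel₀ _ hpos.ne']
  have h1 := h _ hn
  have h2 := hφ.2 hx hb (sub_nonneg.2 hs1) hs0 (by ring)
  rw [show (1 - s) • x + s • b = x + s • (b - x) by module] at h2
  have h3 : φ b ≤ φ x := hmin hx
  simp only [smul_eq_mul] at h2
  linarith [mul_le_mul_of_nonneg_left h3 hs0]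

section Penalized

variable {K : ℕ} {d : Fin K → ℕ} {𝒳 Υ : Type*}

lemma convexOn_objective {B : Set (Param d)} (hB : Convex ℝ B) {f : Param d → 𝒳 → Υ → ℝ}
    {ψ : ∀ k, EuclideanSpace ℝ (Fin (d k)) → ℝ} (hψ : ∀ k, ConvexOn ℝ Set.univ (ψ k))
    {w : Fin K → ℝ} (hw : ∀ k, 0 ≤ w k) {z : ℕ → 𝒳 × Υ}
    (hz : ∀ i, ConcaveOn ℝ B (logLik f (z i))) (n : ℕ) :
    ConvexOn ℝ B (objective f ψ w z n) := by
  have h1 : ConvexOn ℝ B fun β => (n : ℝ)⁻¹ • ∑ i ∈ Finset.range n, -logLik f (z i) β :=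
    (convexOn_finset_sum hB _ fun i _ => (hz i).neg).smul (by positivity)
  have h2 : ConvexOn ℝ B fun β : Param d => ∑ k, w k • ψ k (β k) :=
    convexOn_finset_sum hB _ fun k _ => (((hψ k).comp_linearMap
      (PiLp.proj (𝕜 := ℝ) 2 (fun k : Fin K => EuclideanSpace ℝ (Fin (d k))) k).toLinearMap).subset
        (Set.subset_univ _) hB).smul (hw k)
  refine (h1.add h2).congr fun β _ => ?_
  simp [objective, sampleLogLik]

/-- A weighted sum of convex penalties is locally Lipschitz, with a constant proportional to the
largest weight. -/
lemma exists_penalty_sub_le {ψ : ∀ k, EuclideanSpace ℝ (Fin (d k)) → ℝ}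
    (hψ : ∀ k, ConvexOn ℝ Set.univ (ψ k)) (x : Param d) :
    ∃ L ≥ 0, ∃ δ > 0, ∀ u : Param d, ‖u‖ ≤ δ → ∀ (w : Fin K → ℝ) (a : ℝ), (∀ k, 0 ≤ w k) →
      (∀ k, w k ≤ a) → ∑ k, w k * ψ k (x k) - ∑ k, w k * ψ k ((x + u) k) ≤ a * L * ‖u‖ := by
  choose c t ht hc using fun k => (hψ k).locallyLipschitz (x k)
  have hev : ∀ᶠ u in 𝓝 (0 : Param d), ∀ k, (x + u) k ∈ t k := by
    refine eventually_all.2 fun k => ?_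
    have hcont : ContinuousAt (fun u : Param d => (x + u) k) 0 := by fun_prop
    exact hcont.eventually_mem (by simpa using ht k)
  obtain ⟨δ, hδ, hball⟩ := Metric.nhds_basis_closedBall.eventually_iff.1 hev
  refine ⟨∑ k, (c k : ℝ), by positivity, δ, hδ, fun u hu w a hw hwa => ?_⟩
  rw [← Finset.sum_sub_distrib, mul_assoc, Finset.sum_mul, Finset.mul_sum]
  refine Finset.sum_le_sum fun k _ => ?_
  have h1 := (hc k).dist_le_mul _ (mem_of_mem_nhds (ht k)) _
    (hball (mem_closedBall_zero_iff.2 hu) k)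
  rw [Real.dist_eq, dist_eq_norm] at h1
  have h2 : ‖x k - (x + u) k‖ ≤ ‖u‖ := by
    simpa using PiLp.norm_apply_le u k
  have h3 : ψ k (x k) - ψ k ((x + u) k) ≤ c k * ‖u‖ :=
    (le_abs_self _).trans (h1.trans (mul_le_mul_of_nonneg_left h2 (c k).2))
  rw [← mul_sub]
  exact (mul_le_mul_of_nonneg_left h3 (hw k)).trans
    (mul_le_mul_of_nonneg_right (hwa k) (by positivity))

/-- The penalized objective increases away from `x` where the score is small and the averaged
quadratic expansion is negative. -/
lemma objective_lt_of_norm_eq {f : Param d → 𝒳 → Υ → ℝ}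
    {ψ : ∀ k, EuclideanSpace ℝ (Fin (d k)) → ℝ} {w : Fin K → ℝ} {z : ℕ → 𝒳 × Υ} {n : ℕ}
    (hn : 1 ≤ n) {x u : Param d} {g : ℕ → Param d →L[ℝ] ℝ} {W : ℕ → Param d [×2]→L[ℝ] ℝ}
    {H₀ H : Param d [×2]→L[ℝ] ℝ} {c T L s a : ℝ} (hc : 0 < c) (hT : 0 ≤ T) (hL : 0 ≤ L)
    (hs : 0 < s) (ha : 0 ≤ a)
    (hquad : ∀ i, logLik f (z i) (x + u) - logLik f (z i) x ≤
      g i u + 1 / 2 * W i ![u, u] + c / 8 * ‖u‖ ^ 2)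
    (hg : ‖(n : ℝ)⁻¹ • ∑ i ∈ Finset.range n, g i‖ ≤ T * s)
    (hW : ‖(n : ℝ)⁻¹ • ∑ i ∈ Finset.range n, W i - H₀‖ ≤ c / 8) (hH₀ : ‖H₀ - H‖ ≤ c / 8)
    (hH : H ![u, u] ≤ -c * ‖u‖ ^ 2)
    (hψ : ∑ k, w k * ψ k (x k) - ∑ k, w k * ψ k ((x + u) k) ≤ a * L * ‖u‖)
    (hu : ‖u‖ = 4 * (T + L + 1) / c * (s + a)) :
    objective f ψ w z n x < objective f ψ w z n (x + u) := by
  have hn0 : (0 : ℝ) < n := by exact_mod_cast hn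
  have hform : ∀ A : Param d [×2]→L[ℝ] ℝ, ‖A‖ ≤ c / 8 → A ![u, u] ≤ c / 8 * ‖u‖ ^ 2 := by
    intro A hA
    refine (le_abs_self _).trans ((A.le_opNorm ![u, u]).trans ?_)
    simp only [Fin.prod_univ_two, Matrix.cons_val_zero, Matrix.cons_val_one]
    nlinarith [sq_nonneg ‖u‖]
  have hsum : sampleLogLik f z n (x + u) - sampleLogLik f z n x ≤
      ((n : ℝ)⁻¹ • ∑ i ∈ Finset.range n, g i) u +
        1 / 2 * ((n : ℝ)⁻¹ • ∑ i ∈ Finset.range n, W i) ![u, u] + c / 8 * ‖u‖ ^ 2 := by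
    have h1 := mul_le_mul_of_nonneg_left
      (Finset.sum_le_sum fun i (_ : i ∈ Finset.range n) => hquad i) (inv_nonneg.2 hn0.le)
    simp only [Finset.sum_sub_distrib, Finset.sum_add_distrib, Finset.sum_const,
      Finset.card_range, nsmul_eq_mul, ← Finset.mul_sum] at h1
    have h2 : (n : ℝ)⁻¹ * (n * (c / 8 * ‖u‖ ^ 2)) = c / 8 * ‖u‖ ^ 2 :=
      inv_mul_cancel_left₀ hn0.ne' _
    simp only [sampleLogLik, smul_apply, sum_apply, smul_eq_mul]
    linarith
  have hgu : ((n : ℝ)⁻¹ • ∑ i ∈ Finset.range n, g i) u ≤ T * s * ‖u‖ :=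
    (le_abs_self _).trans ((ContinuousLinearMap.le_opNorm _ u).trans
      (mul_le_mul_of_nonneg_right hg (norm_nonneg _)))
  have h1 := hform _ hW
  have h2 := hform _ hH₀
  simp only [sub_apply] at h1 h2
  have hupos : 0 < ‖u‖ := by rw [hu]; positivity
  -- The Hessian errors leave `½(-c + c/8 + c/8) = -3c/8`, and the Taylor error `c/8` leaves `-c/4`.
  -- The radius makes `c/4 ‖u‖ = (T + L + 1)(s + a)`, and the `+ 1` gives strictness.
  have hkey : T * s * ‖u‖ + a * L * ‖u‖ < c / 4 * ‖u‖ ^ 2 := by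
    have : c / 4 * ‖u‖ ^ 2 = (T + L + 1) * (s + a) * ‖u‖ := by
      rw [sq, ← mul_assoc]
      congr 1
      rw [hu]
      field_simp
    rw [this, ← add_mul]
    refine mul_lt_mul_of_pos_right ?_ hupos
    nlinarith [mul_nonneg hT ha, mul_nonneg hL hs.le]
  simp only [objective]
  linarith

end Penalized

lemma tendsto_inv_sqrt_add_iSup {K : ℕ} {lam : ℕ → Fin K → ℝ} (h0 : ∀ n k, 0 ≤ lam n k)
    (h : ∀ k, Tendsto (fun n => lam n k) atTop (𝓝 0)) :
    Tendsto (fun n : ℕ => (√(n : ℝ))⁻¹ + ⨆ k, lam n k) atTop (𝓝 0) := by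
  have h1 : Tendsto (fun n : ℕ => (√(n : ℝ))⁻¹) atTop (𝓝 0) :=
    tendsto_inv_atTop_zero.comp (Real.tendsto_sqrt_atTop.comp tendsto_natCast_atTop_atTop)
  have h2 : Tendsto (fun n => ∑ k, lam n k) atTop (𝓝 0) := by
    simpa using tendsto_finsetSum Finset.univ fun k _ => h k
  -- Domination by the sum also covers `K = 0`, where the real supremum is zero.
  have h3 : Tendsto (fun n => ⨆ k, lam n k) atTop (𝓝 0) :=
    squeeze_zero (fun n => Real.iSup_nonneg (h0 n)) (fun n => Real.iSup_le
      (fun k => Finset.single_le_sum (fun j _ => h0 n j) (Finset.mem_univ k))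
      (Finset.sum_nonneg fun k _ => h0 n k)) h2
  simpa using h1.add h3

end RegComp

/-! ### The rate of convergence. -/

theorem mainTheorem1
    {K : ℕ} {d : Fin K → ℕ} {V : Fin K → Type*} [∀ k, AddCommGroup (V k)] [∀ k, Module ℝ (V k)]
    {𝒳 Υ Ω : Type*} [MeasurableSpace 𝒳] [MeasurableSpace Υ] [MeasurableSpace Ω]
    -- the model, its parameter set and its densities
    (M : RegComp.Model d V 𝒳 Υ) (ν : Measure Υ) [SigmaFinite ν]
    (B : Set (RegComp.Param d)) (βs : RegComp.Param d) (hβs : βs ∈ interior B)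
    (f : RegComp.Param d → 𝒳 → Υ → ℝ)
    -- an i.i.d. sample `Z i = (X i, Y i)` with law `D` and true parameter `βs`
    (μ : Measure Ω) [IsProbabilityMeasure μ] (D : Measure (𝒳 × Υ)) [IsProbabilityMeasure D]
    (Z : ℕ → Ω → 𝒳 × Υ) (hZmeas : ∀ i, Measurable (Z i)) (hZlaw : ∀ i, μ.map (Z i) = D)
    (hZindep : iIndepFun Z μ)
    (hdens : M.IsDensityOn ν D.fst B f) (htrue : M.IsTrueParam D βs)
    -- the log-likelihood is well defined and concave on the (convex) parameter set
    (hpos : ∀ᵐ z ∂D, ∀ β ∈ B, 0 < f β z.1 z.2)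
    (hconc : ∀ᵐ z ∂D, ConcaveOn ℝ B (RegComp.logLik f z))
    -- the expected log-likelihood is finite near `βs`
    (hint : ∀ᶠ β in 𝓝 βs, Integrable (fun z => RegComp.logLik f z β) D)
    -- score with finite variance; the Fisher information exists and is positive definite
    (hsmooth : ∀ᵐ z ∂D, ContDiffAt ℝ 2 (RegComp.logLik f z) βs)
    (hscore : MemLp (fun z => fderiv ℝ (RegComp.logLik f z) βs) 2 D)
    (hhess : Integrable (fun z => iteratedFDeriv ℝ 2 (RegComp.logLik f z) βs) D)
    (hfisher : ∀ u : RegComp.Param d, u ≠ 0 → 0 < RegComp.fisherInfo D f βs u u)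
    -- convex penalties and tuning parameters
    (ψ : ∀ k, EuclideanSpace ℝ (Fin (d k)) → ℝ) (hψ : ∀ k, ConvexOn ℝ Set.univ (ψ k))
    (lam : ℕ → Fin K → ℝ) (hlam_nonneg : ∀ n k, 0 ≤ lam n k)
    (hlam : ∀ k, Tendsto (fun n => lam n k) atTop (𝓝 0))
    -- the penalized maximum likelihood estimator
    (βhat : ℕ → Ω → RegComp.Param d)
    (hβhat : ∀ n, 1 ≤ n → ∀ᵐ ω ∂μ, βhat n ω ∈ B ∧
      IsMinOn (RegComp.objective f ψ (lam n) (fun i => Z i ω) n) B (βhat n ω)) :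
    RegComp.IsBigOInProb μ (fun n ω => ‖βhat n ω - βs‖)
      (fun n => (Real.sqrt n)⁻¹ + ⨆ k, lam n k) := by
  have hβsB := interior_subset hβs
  have hB_ev : ∀ᶠ β in 𝓝 βs, β ∈ B := mem_interior_iff_mem_nhds.1 hβs
  have hZae : ∀ {p : 𝒳 × Υ → Prop}, (∀ᵐ z ∂D, p z) → ∀ᵐ ω ∂μ, ∀ i, p (Z i ω) := fun hp =>
    ae_all_iff.2 fun i => ae_of_ae_map (hZmeas i).aemeasurable (by rwa [hZlaw])
  have hmean : ∀ u, ∫ z, fderiv ℝ (RegComp.logLik f z) βs u ∂D = 0 :=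
    RegComp.integral_fderiv_apply_eq_zero hβs hconc
      (hsmooth.mono fun z hz => hz.differentiableAt (by simp)) hint
      ((hB_ev.and hint).mono fun β hβ =>
        RegComp.integral_logLik_le hdens htrue hpos hβsB hβ.1 hint.self_of_nhds hβ.2)
      (hscore.integrable (by norm_num))
  obtain ⟨c, hc, hquad⟩ := RegComp.exists_quadratic_le_neg
    (∫ z, iteratedFDeriv ℝ 2 (RegComp.logLik f z) βs ∂D) fun u hu => by
      have h1 := hfisher u hu
      have h2 := (ContinuousMultilinearMap.apply ℝ (fun _ : Fin 2 => RegComp.Param d) ℝ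
        ![u, u]).integral_comp_comm hhess
      simp only [ContinuousMultilinearMap.apply_apply] at h2
      rw [RegComp.fisherInfo, h2] at h1
      linarith
  obtain ⟨δ, hδ, W, hWm, hWi, hWH, hexp⟩ := RegComp.exists_truncated_hessian hβs hconc hsmooth
    (hint.mono fun β hβ => hβ.1.aemeasurable) hscore.1 hhess (ε := c / 8) (by positivity)
  obtain ⟨L, hL, δ', hδ', hpen⟩ := RegComp.exists_penalty_sub_le hψ βs
  intro ε hε
  obtain ⟨T, hT, hTb⟩ := RegComp.exists_measure_average_le hZmeas hZlaw hZindep hscore hmean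
    (half_pos hε)
  have hC : 0 < 4 * (T + L + 1) / c := by positivity
  refine ⟨4 * (T + L + 1) / c, hC, ?_⟩
  have hrate := (RegComp.tendsto_inv_sqrt_add_iSup hlam_nonneg hlam).const_mul
    (4 * (T + L + 1) / c)
  rw [mul_zero] at hrate
  -- The radius tends to zero, so the sphere eventually lies where both the expansion and the
  -- penalty bound hold.
  filter_upwards [eventually_ge_atTop 1, hrate.eventually_lt_const hδ,
    hrate.eventually_lt_const hδ', RegComp.eventually_measure_average_le hZmeas hZlaw hZindep
      hWm hWi (η := c / 8) (by positivity) (ENNReal.ofReal_pos.2 (half_pos hε))]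
    with n hn hnδ hnδ' hlaw
  have hs : 0 < (√(n : ℝ))⁻¹ := by
    have : (0 : ℝ) < n := by exact_mod_cast hn
    positivity
  have ha : 0 ≤ ⨆ k, lam n k := Real.iSup_nonneg (hlam_nonneg n)
  -- Almost surely, the estimator leaves the ball only if the score is large or the averaged
  -- truncated Hessian is far from its mean; each event costs `ε / 2`.
  refine (measure_mono_ae (t := {ω | T * (√n)⁻¹ <
      ‖(n : ℝ)⁻¹ • ∑ i ∈ Finset.range n, fderiv ℝ (RegComp.logLik f (Z i ω)) βs‖} ∪
    {ω | c / 8 ≤ ‖(n : ℝ)⁻¹ • ∑ i ∈ Finset.range n, W (Z i ω) - ∫ z, W z ∂D‖}) ?_).trans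
    ((measure_union_le _ _).trans ((add_le_add (hTb n hn) hlaw).trans ?_))
  · filter_upwards [hβhat n hn, hZae hconc, hZae hexp] with ω hmin hcω heω hω
    by_contra hgood
    have hgood' := not_or.1 hgood
    refine not_le.2 (hω : _ < |‖βhat n ω - βs‖|) ?_
    rw [abs_norm]
    -- Convexity of `B` is part of the concavity statement for the first observation.
    refine (RegComp.convexOn_objective (hcω 0).1 hψ (hlam_nonneg n) hcω n).norm_sub_le_of_isMinOn
      hβsB hmin.1 hmin.2 (by positivity) fun u hu => ?_
    exact RegComp.objective_lt_of_norm_eq hn hc hT.le hL hs ha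
      (fun i => heω i u (hu.trans_lt hnδ).le) (not_lt.1 hgood'.1) (not_le.1 hgood'.2).le hWH
      (hquad u) (hpen u (hu.trans_lt hnδ').le _ _ (hlam_nonneg n)
        fun k => le_ciSup (Set.finite_range _).bddAbove k) hu
  · rw [← ENNReal.ofReal_add (half_pos hε).le (half_pos hε).le, add_halves]
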